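/- Let $\mathbb{R}_{\max}=\mathbb{R}\cup\{-\infty\}$, let $m,n\ge 1$, and let $A=(a_{ij}),B=(b_{ij})\in\mathbb{R}_{\max}^{m\times n}$ be such that neither $A$ nor $B$ has a row all of whose entries are $-\infty$, and no column is identically $-\infty$ in both $A$ and $B$. For $x\in\mathbb{R}_{\max}^n$ write $(Ax)_i=\max_{j}(a_{ij}+x_j)$, and for $y\in\mathbb{R}_{\max}^m$ write $(A^{\sharp}y)_j=\min_{i}(-a_{ij}+y_i)$ with the convention $(+\infty)+(-\infty)=+\infty$ (so only the $i$ with $a_{ij}\neq-\infty$ matter); likewise for $B$. Let $\operatorname{spec}(A,B)$ be the set of $\lambda\in\mathbb{R}$ for which there is $x\in\mathbb{R}_{\max}^n$, not identically $-\infty$, with $Ax=\lambda+Bx$. For $\lambda\in\mathbb{R}$ let $h_\lambda:\mathbb{R}_{\max}^n\to\mathbb{R}_{\max}^n$, $$h_\lambda(x)=(\lambda+A^{\sharp}Bx)\wedge(-\lambda+B^{\sharp}Ax)\quad\text{(componentwise minimum)},$$ and let the spectral function be $s(\lambda)=r(h_\lambda)$, where $r(h_\lambda)=\max\{\mu\in\mathbb{R}_{\max}\mid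 \exists x\in\mathbb{R}_{\max}^n,\ x\not\equiv-\infty,\ \mu+x=h_\lambda(x)\}$ is the largest eigenvalue of $h_\lambda$. Then: 1. for every $\lambda\in\mathbb{R}$ the maximum defining $s(\lambda)$ exists; 2. $s(\lambda)\le 0$ for every $\lambda\in\mathbb{R}$; 3. for every $\lambda\in\mathbb{R}$, $s(\lambda)=0$ if and only if $\lambda\in\operatorname{spec}(A,B)$; 4. if $\operatorname{spec}(A,B)$ is nonempty, then it is a union of finitely many closed intervals and points of $\mathbb{R}$, where closed intervals may be bounded, closed half-lines, or all of $\mathbb{R}$. -/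

import Mathlib

noncomputable section

/-- The max-plus semiring's underlying set, the reals with `-∞ = ⊥` adjoined. The addition of
`WithBot ℝ` (for which `⊥` is absorbing) is the max-plus multiplication, `⊔` the addition. -/
abbrev Rmax : Type := WithBot ℝ

/-- `Rmax` with `+∞ = ⊤` adjoined. The addition satisfies `⊤ + a = a + ⊤ = ⊤` for all `a`,
that is, it follows the convention `(-∞) + (+∞) = +∞`. -/
abbrev RmaxBar : Type := WithTop (WithBot ℝ)

namespace MaxPlus

/-- The max-plus linear map of a matrix: `(A x)_i = max_j (a_ij + x_j)`. -/
def act {m n : ℕ} (A : Matrix (Fin m) (Fin n) Rmax) (x : Fin n → Rmax) : Fin m → Rmax :=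
  fun i => Finset.univ.sup fun j => A i j + x j

/-- Negation `a ↦ -a` from `Rmax` to `RmaxBar`, with `-(-∞) = +∞`. -/
def neg : Rmax → RmaxBar
  | none => ⊤
  | some a => (((-a : ℝ) : WithBot ℝ) : WithTop (WithBot ℝ))

/-- The residuated operator: `(A^♯ y)_j = min_i (-a_ij + y_i)`. -/
def residual {m n : ℕ} (A : Matrix (Fin m) (Fin n) Rmax) (y : Fin m → RmaxBar) :
    Fin n → RmaxBar :=
  fun j => Finset.univ.inf fun i => neg (A i j) + y i

/-- The min-max function `h_l(x) = (l + A^♯ B x) ∧ (-l + B^♯ A x)`, for real `l`.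
Its values lie in `Rmax^n` if `A` and `B` have no common `-∞` column, see `minMax_ne_top`. -/
def minMax {m n : ℕ} (A B : Matrix (Fin m) (Fin n) Rmax) (l : ℝ) (x : Fin n → Rmax) :
    Fin n → RmaxBar :=
  fun j =>
    (((l : Rmax) : RmaxBar) + residual A (fun i => (act B x i : RmaxBar)) j) ⊓
      (((-l : ℝ) : Rmax) + residual B (fun i => (act A x i : RmaxBar)) j)

/-- `μ ∈ Rmax` is an eigenvalue of `f` if `f(x) = μ + x` for some `x ∈ Rmax^n` that is not
identically `-∞`. -/
def IsEigenvalue {n : ℕ} (f : (Fin n → Rmax) → (Fin n → RmaxBar)) (μ : Rmax) : Prop :=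
  ∃ x : Fin n → Rmax, (∃ j, x j ≠ ⊥) ∧ ∀ j, f x j = ((μ + x j : Rmax) : RmaxBar)

/-- The spectral radius `r(f)`, the largest eigenvalue of `f`. -/
def specRadius {n : ℕ} (f : (Fin n → Rmax) → (Fin n → RmaxBar)) : Rmax :=
  sSup {μ : Rmax | IsEigenvalue f μ}

/-- The spectral function `s(l) = r(h_l)` of the pair `(A, B)`. -/
def specFun {m n : ℕ} (A B : Matrix (Fin m) (Fin n) Rmax) (l : ℝ) : Rmax :=
  specRadius (minMax A B l)

/-- The (finite) spectrum of `(A, B)`: the real `l` for which `A x = l + B x` has a solution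
`x ∈ Rmax^n` that is not identically `-∞`. -/
def spec {m n : ℕ} (A B : Matrix (Fin m) (Fin n) Rmax) : Set ℝ :=
  {l : ℝ | ∃ x : Fin n → Rmax, (∃ j, x j ≠ ⊥) ∧ ∀ i, act A x i = (l : Rmax) + act B x i}

/-- Nonempty closed intervals of the real line: `[a, b]` with `a ≤ b` (a point if `a = b`),
`[a, ∞)`, `(-∞, b]` and the whole line. -/
def IsClosedInterval (I : Set ℝ) : Prop :=
  (∃ a b : ℝ, a ≤ b ∧ I = Set.Icc a b) ∨ (∃ a : ℝ, I = Set.Ici a) ∨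
    (∃ b : ℝ, I = Set.Iic b) ∨ I = Set.univ

theorem neg_ne_top {a : Rmax} (h : a ≠ ⊥) : neg a ≠ ⊤ := by
  induction a using WithBot.recBotCoe with
  | bot => exact absurd rfl h
  | coe a => exact WithTop.coe_ne_top

theorem residual_ne_top {m n : ℕ} (A : Matrix (Fin m) (Fin n) Rmax) (y : Fin m → Rmax)
    {i : Fin m} {j : Fin n} (h : A i j ≠ ⊥) :
    residual A (fun i => (y i : RmaxBar)) j ≠ ⊤ := by
  refine ne_top_of_le_ne_top ?_ (Finset.inf_le (Finset.mem_univ i))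
  exact WithTop.add_ne_top.2 ⟨neg_ne_top h, WithTop.coe_ne_top⟩

/-- Without common `-∞` columns, `h_l` maps `Rmax^n` to itself. -/
theorem minMax_ne_top {m n : ℕ} (A B : Matrix (Fin m) (Fin n) Rmax)
    (hcol : ∀ j, ∃ i, A i j ≠ ⊥ ∨ B i j ≠ ⊥) (l : ℝ) (x : Fin n → Rmax) (j : Fin n) :
    minMax A B l x j ≠ ⊤ := by
  obtain ⟨i, h | h⟩ := hcol j
  · exact ne_top_of_le_ne_top
      (WithTop.add_ne_top.2 ⟨WithTop.coe_ne_top, residual_ne_top A _ h⟩) inf_le_left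
  · exact ne_top_of_le_ne_top
      (WithTop.add_ne_top.2 ⟨WithTop.coe_ne_top, residual_ne_top B _ h⟩) inf_le_right

end MaxPlus

end

/-! Residuation turns `z ≤ h_l(x)` into the pair `A z ≤ l + B x`, `B z ≤ -l + A x`
(`le_minMaxMap_iff`). For `z = x` the pair says `A x = l + B x`, so `l` is in the spectrum iff `0`
is a subeigenvalue of `h_l`; for `z = μ + x`, chaining the two gives `2μ ≤ 0`.

What remains for the first three claims is an eigenvalue that dominates all subeigenvalues
(`exists_eigenvalue`), found by a vanishing discount. Being monotone and commuting with
translations, `h_l` is nonexpansive on `ℝ^n`, so `x ↦ h_l(t x)` has a fixed point for `t < 1`.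
Subtracting its largest entry gives `h_l(t y) = μ_t + y` with `y` in a compact set and `μ_t`
bounded; compactness yields a solution at `t = 1`, possibly with entries `-∞`.

For the last claim, fixing where the maxima in `A x` and `B x` are attained, and one finite
coordinate of `x`, cuts the spectrum into finitely many convex pieces. The spectrum is closed, so
the pieces may be replaced by their closures. -/

namespace MaxPlus

open Filter Topology Set

/-! ### Residuation and the min-max map -/

section Algebra

/-- Translation by a real number, as an order automorphism of `Rmax`. -/
def shift (c : ℝ) : Rmax ≃o Rmax where
  toFun x := (c : Rmax) + x
  invFun x := ((-c : ℝ) : Rmax) + x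
  left_inv x := by simp [← add_assoc, ← WithBot.coe_add]
  right_inv x := by simp [← add_assoc, ← WithBot.coe_add]
  map_rel_iff' := by
    intro x y
    refine ⟨fun h => ?_, fun h => add_le_add_right h (c : Rmax)⟩
    have := add_le_add_right h ((-c : ℝ) : Rmax)
    simpa [← add_assoc, ← WithBot.coe_add] using this

/-- Translation by a real number, as an order automorphism of `RmaxBar`. -/
def shiftBar (c : ℝ) : RmaxBar ≃o RmaxBar where
  toFun x := ((c : Rmax) : RmaxBar) + x
  invFun x := (((-c : ℝ) : Rmax) : RmaxBar) + x
  left_inv x := by simp [← add_assoc, ← WithTop.coe_add, ← WithBot.coe_add]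
  right_inv x := by simp [← add_assoc, ← WithTop.coe_add, ← WithBot.coe_add]
  map_rel_iff' := by
    intro x y
    refine ⟨fun h => ?_, fun h => add_le_add_right h ((c : Rmax) : RmaxBar)⟩
    have := add_le_add_right h (((-c : ℝ) : Rmax) : RmaxBar)
    simpa [← add_assoc, ← WithTop.coe_add, ← WithBot.coe_add] using this

theorem shift_apply (c : ℝ) (x : Rmax) : shift c x = (c : Rmax) + x := rfl

theorem shiftBar_apply (c : ℝ) (x : RmaxBar) : shiftBar c x = ((c : Rmax) : RmaxBar) + x := rfl

variable {m n : ℕ} (A B : Matrix (Fin m) (Fin n) Rmax)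

theorem act_le_iff {x : Fin n → Rmax} {i : Fin m} {a : Rmax} :
    act A x i ≤ a ↔ ∀ j, A i j + x j ≤ a := by
  simp [act]

theorem le_act (x : Fin n → Rmax) (i : Fin m) (j : Fin n) : A i j + x j ≤ act A x i :=
  (act_le_iff A).1 le_rfl j

theorem act_mono {x y : Fin n → Rmax} (h : x ≤ y) : act A x ≤ act A y :=
  fun i => (act_le_iff A).2 fun j => (add_le_add_right (h j) _).trans (le_act A y i j)

theorem act_shift (c : ℝ) (x : Fin n → Rmax) (i : Fin m) :
    act A (fun j => (c : Rmax) + x j) i = (c : Rmax) + act A x i := by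
  rw [act, act, ← shift_apply, map_finset_sup]
  refine Finset.sup_congr rfl fun j _ => ?_
  simp only [Function.comp, shift_apply]
  exact add_left_comm _ _ _

theorem act_add (μ : Rmax) (x : Fin n → Rmax) (i : Fin m) :
    act A (fun j => μ + x j) i = μ + act A x i := by
  induction μ using WithBot.recBotCoe with
  | bot => simp [act]
  | coe c => exact act_shift A c x i

theorem act_ne_bot {x : Fin n → Rmax} {i : Fin m} {j : Fin n} (ha : A i j ≠ ⊥) (hx : x j ≠ ⊥) :
    act A x i ≠ ⊥ :=
  ne_bot_of_le_ne_bot (by simp [WithBot.add_eq_bot, ha, hx]) (le_act A x i j)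

theorem exists_act_eq (hn : 0 < n) (x : Fin n → Rmax) (i : Fin m) :
    ∃ j, act A x i = A i j + x j := by
  obtain ⟨j, -, hj⟩ := Finset.exists_mem_eq_sup Finset.univ ⟨(⟨0, hn⟩ : Fin n), Finset.mem_univ _⟩
    fun j => A i j + x j
  exact ⟨j, hj⟩

theorem residual_mono {x y : Fin m → RmaxBar} (h : x ≤ y) : residual A x ≤ residual A y :=
  fun _ => Finset.inf_mono_fun fun i _ => add_le_add_right (h i) _

theorem residual_shift (c : ℝ) (y : Fin m → RmaxBar) (j : Fin n) :
    residual A (fun i => ((c : Rmax) : RmaxBar) + y i) j =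
      ((c : Rmax) : RmaxBar) + residual A y j := by
  rw [residual, residual, ← shiftBar_apply, map_finset_inf]
  refine Finset.inf_congr rfl fun j _ => ?_
  simp only [Function.comp, shiftBar_apply]
  exact add_left_comm _ _ _

/-- The convention `⊤ + ⊥ = ⊤` makes this valid for `a = ⊥`, where both sides always hold. -/
theorem coe_le_neg_add_iff (a y z : Rmax) :
    (z : RmaxBar) ≤ neg a + (y : RmaxBar) ↔ a + z ≤ y := by
  induction a using WithBot.recBotCoe with
  | bot =>
    have : neg ⊥ = ⊤ := rfl
    simp [this]
  | coe a =>
    have : neg (a : Rmax) = (((-a : ℝ) : Rmax) : RmaxBar) := rfl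
    rw [this, ← WithTop.coe_add, WithTop.coe_le_coe, ← (shift a).le_iff_le, shift_apply,
      shift_apply, ← add_assoc, ← WithBot.coe_add]
    simp

theorem coe_le_add_residual_iff (l : ℝ) (y : Fin m → Rmax) (z : Rmax) (j : Fin n) :
    (z : RmaxBar) ≤ ((l : Rmax) : RmaxBar) + residual A (fun i => (y i : RmaxBar)) j ↔
      ∀ i, A i j + z ≤ (l : Rmax) + y i := by
  rw [← residual_shift, residual, Finset.le_inf_iff]
  simp only [Finset.mem_univ, true_imp_iff, ← WithTop.coe_add, coe_le_neg_add_iff]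

theorem le_minMax_iff (l : ℝ) (x z : Fin n → Rmax) :
    (∀ j, (z j : RmaxBar) ≤ minMax A B l x j) ↔
      ∀ i, act A z i ≤ (l : Rmax) + act B x i ∧ act B z i ≤ ((-l : ℝ) : Rmax) + act A x i := by
  simp only [minMax, le_inf_iff, coe_le_add_residual_iff, act_le_iff]
  exact ⟨fun h i => ⟨fun j => (h j).1 i, fun j => (h j).2 i⟩,
    fun h j => ⟨fun i => (h i).1 j, fun i => (h i).2 j⟩⟩

theorem minMax_mono (l : ℝ) {x y : Fin n → Rmax} (h : x ≤ y) :
    minMax A B l x ≤ minMax A B l y := fun j =>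
  inf_le_inf
    (add_le_add_right (residual_mono A (fun i => WithTop.coe_le_coe.2 (act_mono B h i)) j) _)
    (add_le_add_right (residual_mono B (fun i => WithTop.coe_le_coe.2 (act_mono A h i)) j) _)

theorem minMax_shift (l c : ℝ) (x : Fin n → Rmax) (j : Fin n) :
    minMax A B l (fun j => (c : Rmax) + x j) j = ((c : Rmax) : RmaxBar) + minMax A B l x j := by
  rw [minMax, minMax, ← shiftBar_apply c, (shiftBar c).monotone.map_min]
  simp only [act_shift, WithTop.coe_add, residual_shift, shiftBar_apply]
  rw [add_left_comm, add_left_comm (((-l : ℝ) : Rmax) : RmaxBar)]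

/-- `h_l` as a self-map of `Rmax^n`. -/
def minMaxMap (hcol : ∀ j, ∃ i, A i j ≠ ⊥ ∨ B i j ≠ ⊥) (l : ℝ) (x : Fin n → Rmax) :
    Fin n → Rmax :=
  fun j => (minMax A B l x j).untop (minMax_ne_top A B hcol l x j)

variable {A B} (hcol : ∀ j, ∃ i, A i j ≠ ⊥ ∨ B i j ≠ ⊥)

theorem coe_minMaxMap (l : ℝ) (x : Fin n → Rmax) (j : Fin n) :
    (minMaxMap A B hcol l x j : RmaxBar) = minMax A B l x j :=
  WithTop.coe_untop _ _

theorem minMaxMap_mono (l : ℝ) : Monotone (minMaxMap A B hcol l) := fun x y h j => by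
  rw [← WithTop.coe_le_coe, coe_minMaxMap, coe_minMaxMap]
  exact minMax_mono A B l h j

theorem minMaxMap_shift (l c : ℝ) (x : Fin n → Rmax) (j : Fin n) :
    minMaxMap A B hcol l (fun j => (c : Rmax) + x j) j = (c : Rmax) + minMaxMap A B hcol l x j := by
  rw [← WithTop.coe_inj, WithTop.coe_add, coe_minMaxMap, coe_minMaxMap, minMax_shift]

theorem le_minMaxMap_iff (l : ℝ) (x z : Fin n → Rmax) :
    (∀ j, z j ≤ minMaxMap A B hcol l x j) ↔
      ∀ i, act A z i ≤ (l : Rmax) + act B x i ∧ act B z i ≤ ((-l : ℝ) : Rmax) + act A x i := by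
  rw [← le_minMax_iff]
  simp only [← coe_minMaxMap hcol, WithTop.coe_le_coe]

theorem isEigenvalue_minMax_iff (l : ℝ) (μ : Rmax) :
    IsEigenvalue (minMax A B l) μ ↔
      ∃ x : Fin n → Rmax, (∃ j, x j ≠ ⊥) ∧ ∀ j, minMaxMap A B hcol l x j = μ + x j := by
  simp only [IsEigenvalue, ← coe_minMaxMap hcol, WithTop.coe_inj]

/-- If no row of `A` or `B` is identically `-∞`, then `h_l` preserves `ℝ^n`. -/
theorem minMaxMap_ne_bot (hA : ∀ i, ∃ j, A i j ≠ ⊥) (hB : ∀ i, ∃ j, B i j ≠ ⊥) (l : ℝ)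
    (x : Fin n → ℝ) (j : Fin n) : minMaxMap A B hcol l (fun j => (x j : Rmax)) j ≠ ⊥ := by
  set X : Fin n → Rmax := fun j => (x j : Rmax)
  have key : ∀ a y : Rmax, y ≠ ⊥ → neg a + (y : RmaxBar) ≠ ((⊥ : Rmax) : RmaxBar) := by
    intro a y hy h
    induction a using WithBot.recBotCoe with
    | bot =>
      have h0 : neg ⊥ = ⊤ := rfl
      rw [h0, WithTop.top_add] at h
      exact WithTop.top_ne_coe h
    | coe a =>
      have h0 : neg (a : Rmax) = (((-a : ℝ) : Rmax) : RmaxBar) := rfl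
      rw [h0, ← WithTop.coe_add, WithTop.coe_inj, WithBot.add_eq_bot] at h
      exact h.elim WithBot.coe_ne_bot hy
  have res : ∀ (C : Matrix (Fin m) (Fin n) Rmax) (y : Fin m → Rmax), (∀ i, y i ≠ ⊥) →
      ∀ c : ℝ, ((c : Rmax) : RmaxBar) + residual C (fun i => (y i : RmaxBar)) j ≠
        ((⊥ : Rmax) : RmaxBar) := by
    intro C y hy c
    rw [← residual_shift]
    refine (bot_lt_iff_ne_bot (a := (_ : RmaxBar))).1 ((Finset.lt_inf_iff (WithTop.coe_lt_top _)).2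
      fun i _ => bot_lt_iff_ne_bot.2 ?_)
    exact key (C i j) ((c : Rmax) + y i) (by simp [WithBot.add_eq_bot, hy i])
  have real : ∀ C : Matrix (Fin m) (Fin n) Rmax, (∀ i, ∃ j, C i j ≠ ⊥) → ∀ i, act C X i ≠ ⊥ := by
    intro C hC i
    obtain ⟨k, hk⟩ := hC i
    exact act_ne_bot C hk WithBot.coe_ne_bot
  rw [Ne, ← WithTop.coe_inj, coe_minMaxMap, minMax]
  rcases min_choice
    (((l : Rmax) : RmaxBar) + residual A (fun i => (act B X i : RmaxBar)) j)
    ((((-l : ℝ) : Rmax) : RmaxBar) + residual B (fun i => (act A X i : RmaxBar)) j) with h | h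
  · rw [h]; exact res A _ (real B hB) l
  · rw [h]; exact res B _ (real A hA) (-l)

end Algebra

/-! ### Subeigenvalues and the two-sided equation -/

section Spectrum

variable {m n : ℕ} {A B : Matrix (Fin m) (Fin n) Rmax}

theorem le_of_add_le_add_right_ne_bot {a b c : Rmax} (hc : c ≠ ⊥) (h : a + c ≤ b + c) : a ≤ b := by
  lift c to ℝ using hc
  rw [add_comm a, add_comm b] at h
  exact (shift c).le_iff_le.1 h

theorem subeigenvalue_nonpos (hcol : ∀ j, ∃ i, A i j ≠ ⊥ ∨ B i j ≠ ⊥) {l : ℝ} {μ : Rmax}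
    {x : Fin n → Rmax} (hx : ∃ j, x j ≠ ⊥) (h : ∀ j, μ + x j ≤ minMaxMap A B hcol l x j) :
    μ ≤ 0 := by
  obtain ⟨j, hj⟩ := hx
  obtain ⟨i, hi⟩ := hcol j
  obtain ⟨h1, h2⟩ := (le_minMaxMap_iff hcol l x fun j => μ + x j).1 h i
  rw [act_add] at h1 h2
  -- Substituting each inequality into the other gives `2μ + A x ≤ A x` and the same for `B`, in row
  -- `i`. By the choice of `i` and `j`, one of `(A x)_i`, `(B x)_i` is finite and cancels.
  have twice : μ + μ ≤ 0 := by
    have h3 : (l : Rmax) + (μ + act B x i) ≤ act A x i := by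
      refine (add_le_add_right h2 _).trans_eq ?_
      rw [← add_assoc, ← WithBot.coe_add]; simp
    have h4 : ((-l : ℝ) : Rmax) + (μ + act A x i) ≤ act B x i := by
      refine (add_le_add_right h1 _).trans_eq ?_
      rw [← add_assoc, ← WithBot.coe_add]; simp
    rcases hi with hi | hi
    · refine le_of_add_le_add_right_ne_bot (act_ne_bot A hi hj) ?_
      rw [zero_add, add_assoc]
      refine (add_le_add_right h1 _).trans ((add_left_comm _ _ _).trans_le h3)
    · refine le_of_add_le_add_right_ne_bot (act_ne_bot B hi hj) ?_
      rw [zero_add, add_assoc]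
      refine (add_le_add_right h2 _).trans ((add_left_comm _ _ _).trans_le h4)
  induction μ using WithBot.recBotCoe with
  | bot => exact bot_le
  | coe a =>
    norm_cast at twice ⊢
    linarith

theorem le_minMaxMap_self_iff (hcol : ∀ j, ∃ i, A i j ≠ ⊥ ∨ B i j ≠ ⊥) (l : ℝ) (x : Fin n → Rmax) :
    (∀ j, x j ≤ minMaxMap A B hcol l x j) ↔ ∀ i, act A x i = (l : Rmax) + act B x i := by
  rw [le_minMaxMap_iff]
  refine forall_congr' fun i => ?_
  rw [← (shift l).le_iff_le (x := act B x i), shift_apply, shift_apply, ← add_assoc,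
    ← WithBot.coe_add, add_neg_cancel, WithBot.coe_zero, zero_add, le_antisymm_iff]

end Spectrum

/-! ### Continuity and compactness in max-plus space -/

section Topology

instance : TopologicalSpace Rmax := Preorder.topology _

instance : OrderTopology Rmax := ⟨rfl⟩

theorem isOpenEmbedding_coe : IsOpenEmbedding ((↑) : ℝ → Rmax) := by
  have hr : range ((↑) : ℝ → Rmax) = Ioi ⊥ := WithBot.range_coe
  refine ⟨WithBot.coe_strictMono.isEmbedding_of_ordConnected ?_, ?_⟩
  · rw [hr]; exact ordConnected_Ioi
  · rw [hr]; exact isOpen_Ioi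

/-- Continuity at `⊥` is the decay of `g` at `-∞`, locally uniform in the parameter, which is
`hbot`; elsewhere it is inherited because `ℝ` is open in `Rmax`. -/
theorem continuous_map {T : Type*} [TopologicalSpace T] {g : T → ℝ → ℝ}
    (hg : Continuous fun p : T × ℝ => g p.1 p.2)
    (hbot : ∀ t c, ∃ d, ∀ᶠ s in 𝓝 t, ∀ a < d, g s a < c) :
    Continuous fun p : T × Rmax => WithBot.map (g p.1) p.2 := by
  rw [continuous_iff_continuousAt]
  rintro ⟨t, x⟩
  induction x using WithBot.recBotCoe with
  | bot =>
    refine tendsto_order.2 ⟨fun b hb => absurd hb not_lt_bot, fun b hb => ?_⟩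
    obtain ⟨c, hc⟩ : ∃ c : ℝ, (c : Rmax) ≤ b := by
      lift b to ℝ using (show ⊥ < b from hb).ne'
      exact ⟨b, le_rfl⟩
    obtain ⟨d, hd⟩ := hbot t c
    have h2 : ∀ᶠ x : Rmax in 𝓝 ⊥, x < d := Iio_mem_nhds (WithBot.bot_lt_coe d)
    rw [nhds_prod_eq]
    filter_upwards [hd.prod_mk h2] with p hp
    obtain ⟨s, y⟩ := p
    induction y using WithBot.recBotCoe with
    | bot => exact hb
    | coe a => exact (WithBot.coe_lt_coe.2 (hp.1 a (WithBot.coe_lt_coe.1 hp.2))).trans_le hc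
  | coe a =>
    have e : 𝓝 (t, (a : Rmax)) = map (Prod.map id (↑)) (𝓝 (t, a)) :=
      ((IsOpenEmbedding.id.prodMap isOpenEmbedding_coe).map_nhds_eq (t, a)).symm
    rw [ContinuousAt, e, tendsto_map'_iff]
    exact ((isOpenEmbedding_coe.continuous.comp hg).tendsto (t, a))

theorem continuous_coe_add : Continuous fun p : ℝ × Rmax => (p.1 : Rmax) + p.2 := by
  convert continuous_map (T := ℝ) (g := fun t a => t + a) (by fun_prop) ?_ using 2 with p
  · obtain ⟨t, x⟩ := p
    induction x using WithBot.recBotCoe <;> rfl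
  · intro t c
    refine ⟨c - t - 1, ?_⟩
    filter_upwards [Iio_mem_nhds (lt_add_one t)] with s hs a ha
    rw [mem_Iio] at hs
    linarith

/-- Multiplication of an element of `Rmax` by a real number, truncated below at `1/2`. -/
noncomputable def scale (t : ℝ) : Rmax → Rmax := WithBot.map fun a => max t (1 / 2) * a

/-- The truncation keeps the slope at least `1/2`, so `a < -2|c|` forces a product below `-|c| ≤ c`
for every `t`. -/
theorem continuous_scale : Continuous fun p : ℝ × Rmax => scale p.1 p.2 := by
  refine continuous_map (T := ℝ) (g := fun t a => max t (1 / 2) * a) (by fun_prop) fun t c => ⟨-2 * |c|, Eventually.of_forall fun s a ha => ?_⟩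
  have h1 : 1 / 2 ≤ max s (1 / 2) := le_max_right _ _
  have h2 := neg_abs_le c
  have h3 : 0 ≤ |c| := abs_nonneg c
  nlinarith

theorem scale_one (x : Rmax) : scale 1 x = x := by
  have : max (1 : ℝ) (1 / 2) = 1 := by norm_num
  rw [scale, this]
  induction x using WithBot.recBotCoe <;> simp

theorem continuous_act {m n : ℕ} (A : Matrix (Fin m) (Fin n) Rmax) : Continuous (act A) := by
  refine continuous_pi fun i => Continuous.finset_sup_apply fun j _ => ?_
  generalize A i j = a
  induction a using WithBot.recBotCoe with
  | bot => simpa using continuous_const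
  | coe a => exact (shift a).continuous.comp (continuous_apply j)

theorem continuous_minMaxMap {m n : ℕ} {A B : Matrix (Fin m) (Fin n) Rmax}
    (hcol : ∀ j, ∃ i, A i j ≠ ⊥ ∨ B i j ≠ ⊥) (l : ℝ) : Continuous (minMaxMap A B hcol l) := by
  have res : ∀ (C D : Matrix (Fin m) (Fin n) Rmax) (c : ℝ) (j : Fin n),
      Continuous fun x => ((c : Rmax) : RmaxBar) +
        residual C (fun i => (act D x i : RmaxBar)) j := by
    intro C D c j
    refine (shiftBar c).continuous.comp (Continuous.finset_inf_apply fun i _ => ?_)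
    have hD : Continuous fun x => (act D x i : RmaxBar) :=
      WithTop.continuous_coe.comp ((continuous_apply i).comp (continuous_act D))
    generalize C i j = a
    induction a using WithBot.recBotCoe with
    | bot =>
      have h0 : neg ⊥ = ⊤ := rfl
      simpa [h0] using continuous_const
    | coe a => exact (shiftBar (-a)).continuous.comp hD
  refine continuous_pi fun j => WithTop.isEmbedding_coe.continuous_iff.2 ?_
  have : ((↑) : Rmax → RmaxBar) ∘ (fun x => minMaxMap A B hcol l x j) =
      fun x => minMax A B l x j := funext fun x => coe_minMaxMap hcol l x j
  rw [this]
  exact (res A B l j).inf (res B A (-l) j)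

/-- The vectors of `Rmax^n` with largest entry `0`. -/
def normalized (n : ℕ) : Set (Fin n → Rmax) := {x | x ≤ 0 ∧ ∃ j, x j = 0}

theorem isCompact_normalized (n : ℕ) : IsCompact (normalized n) := by
  refine (isCompact_Icc (a := (⊥ : Fin n → Rmax)) (b := 0)).of_isClosed_subset ?_
    fun x hx => ⟨bot_le, hx.1⟩
  have : normalized n = Iic 0 ∩ ⋃ j, {x | x j = 0} := by ext x; simp [normalized]
  rw [this]
  exact isClosed_Iic.inter (isClosed_iUnion_of_finite fun j =>
    isClosed_eq (continuous_apply j) continuous_const)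

instance (n : ℕ) : CompactSpace (normalized n) :=
  isCompact_iff_compactSpace.1 (isCompact_normalized n)

theorem exists_shift_mem_normalized {n : ℕ} {x : Fin n → Rmax} (hx : ∃ j, x j ≠ ⊥) :
    ∃ c : ℝ, (fun j => ((-c : ℝ) : Rmax) + x j) ∈ normalized n := by
  obtain ⟨j, hj⟩ := hx
  obtain ⟨k, -, hk⟩ := Finset.exists_max_image Finset.univ x ⟨j, Finset.mem_univ j⟩
  obtain ⟨c, hc⟩ := WithBot.ne_bot_iff_exists.1 (ne_bot_of_le_ne_bot hj (hk j (Finset.mem_univ j)))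
  have h0 : ((-c : ℝ) : Rmax) + (c : Rmax) = 0 := by
    rw [← WithBot.coe_add, neg_add_cancel]; rfl
  refine ⟨c, fun i => ?_, k, ?_⟩
  · refine (add_le_add_right (hk i (Finset.mem_univ i)) _).trans_eq ?_
    rw [← hc, h0]; rfl
  · simp only [← hc, h0]

/-- Solutions can be normalized into a compact set, and projection along a compact factor is a
closed map. -/
theorem isClosed_spec {m n : ℕ} (A B : Matrix (Fin m) (Fin n) Rmax) : IsClosed (spec A B) := by
  have hC : IsClosed {p : ℝ × normalized n |
      ∀ i, act A p.2.1 i = (p.1 : Rmax) + act B p.2.1 i} := by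
    simp only [ofPred_forall]
    have hact : ∀ (C : Matrix (Fin m) (Fin n) Rmax) i,
        Continuous fun p : ℝ × normalized n => act C p.2.1 i := fun C i =>
      (continuous_apply i).comp ((continuous_act C).comp
        (continuous_subtype_val.comp continuous_snd))
    exact isClosed_iInter fun i => isClosed_eq (hact A i)
      (continuous_coe_add.comp (continuous_fst.prodMk (hact B i)))
  convert isClosedMap_fst_of_compactSpace _ hC using 1
  ext l
  constructor
  · rintro ⟨x, hx, h⟩
    obtain ⟨c, hc⟩ := exists_shift_mem_normalized hx
    refine ⟨(l, ⟨_, hc⟩), fun i => ?_, rfl⟩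
    simp only [act_shift, h i]
    exact add_left_comm _ _ _
  · rintro ⟨⟨l', x, hx, j, hj⟩, h, rfl⟩
    exact ⟨x, ⟨j, by simp [hj]⟩, h⟩

end Topology

/-! ### Vanishing discount and the largest eigenvalue -/

section Eigenvalue

variable {n : ℕ}

/-- Apply `g` to `x ≤ dist x y + y`, and exchange `x` and `y`. -/
theorem dist_le_of_monotone_of_shift {g : (Fin n → ℝ) → Fin n → ℝ} (hmono : Monotone g)
    (hshift : ∀ (c : ℝ) x j, g (fun j => c + x j) j = c + g x j) (x y : Fin n → ℝ) :
    dist (g x) (g y) ≤ dist x y := by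
  have key : ∀ x y : Fin n → ℝ, ∀ j, g x j ≤ dist x y + g y j := fun x y j => by
    rw [← hshift]
    refine hmono (fun k => ?_) j
    have := (le_abs_self _).trans ((Real.dist_eq _ _).symm.trans_le (dist_le_pi_dist x y k))
    linarith
  refine (dist_pi_le_iff dist_nonneg).2 fun j => ?_
  have h1 := key x y j
  have h2 := key y x j
  rw [dist_comm y x] at h2
  rw [Real.dist_eq, abs_le]
  constructor <;> linarith

/-- The map `x ↦ g (t • x)` contracts by `t`. Comparing its fixed point with the image of `0` bounds
`(1 - t) * ‖x‖` uniformly in `t`, which keeps the approximate eigenvalues bounded. -/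
theorem exists_discounted_fixedPoint {g : (Fin n → ℝ) → Fin n → ℝ} (hmono : Monotone g)
    (hshift : ∀ (c : ℝ) x j, g (fun j => c + x j) j = c + g x j) {t : ℝ} (h0 : 0 ≤ t)
    (h1 : t < 1) : ∃ x, g (t • x) = x ∧ (1 - t) * ‖x‖ ≤ ‖g 0‖ := by
  have hdist : ∀ x y, dist (g (t • x)) (g (t • y)) ≤ t * dist x y := fun x y => by
    refine (dist_le_of_monotone_of_shift hmono hshift _ _).trans_eq ?_
    rw [dist_smul₀, Real.norm_of_nonneg h0]
  have hc : ContractingWith ⟨t, h0⟩ fun x => g (t • x) :=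
    ⟨by exact_mod_cast h1, LipschitzWith.of_dist_le_mul hdist⟩
  refine ⟨hc.fixedPoint, hc.fixedPoint_isFixedPt, ?_⟩
  set x := hc.fixedPoint
  have hx : g (t • x) = x := hc.fixedPoint_isFixedPt
  have h2 := hdist x 0
  rw [hx, smul_zero, dist_zero_right] at h2
  have h3 : ‖x‖ ≤ dist x (g 0) + ‖g 0‖ := by
    simpa using dist_triangle x (g 0) 0
  linarith

/-- A solution of the discounted spectral equation whose value bounds every subeigenvalue. -/
theorem exists_discounted_eigenvalue (hn : 0 < n) {f : (Fin n → Rmax) → Fin n → Rmax}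
    (hmono : Monotone f)
    (hshift : ∀ (c : ℝ) x j, f (fun j => (c : Rmax) + x j) j = (c : Rmax) + f x j)
    (hreal : ∀ (x : Fin n → ℝ) j, f (fun j => (x j : Rmax)) j ≠ ⊥) :
    ∃ M : ℝ, ∀ t ∈ Ico (1 / 2 : ℝ) 1, ∃ μ ∈ Icc (-M) M, ∃ y ∈ normalized n,
      (∀ j, f (fun j => scale t (y j)) j = (μ : Rmax) + y j) ∧
      ∀ (ν : ℝ) (z : Fin n → Rmax), (∃ j, z j ≠ ⊥) → (∀ j, (ν : Rmax) + z j ≤ f z j) → ν ≤ μ := by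
  choose g hg using fun x j => WithBot.ne_bot_iff_exists.1 (hreal x j)
  have gmono : Monotone g := fun x y h j => by
    rw [← WithBot.coe_le_coe, hg, hg]
    exact hmono (fun k => WithBot.coe_le_coe.2 (h k)) j
  have gshift : ∀ (c : ℝ) x j, g (fun j => c + x j) j = c + g x j := fun c x j => by
    rw [← WithBot.coe_inj, WithBot.coe_add, hg, hg, ← hshift]
    rfl
  refine ⟨‖g 0‖, fun t ht => ?_⟩
  obtain ⟨x, hx, hbound⟩ := exists_discounted_fixedPoint gmono gshift (by linarith [ht.1]) ht.2
  have ht1 : 0 < 1 - t := by linarith [ht.2]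
  have hmax : max t (1 / 2) = t := max_eq_left ht.1
  obtain ⟨k, -, hk⟩ := Finset.exists_max_image Finset.univ x
    ⟨(⟨0, hn⟩ : Fin n), Finset.mem_univ _⟩
  have hk : ∀ j, x j ≤ x k := fun j => hk j (Finset.mem_univ j)
  have hnorm : |(1 - t) * x k| ≤ ‖g 0‖ := by
    rw [abs_mul, abs_of_pos ht1]
    exact (mul_le_mul_of_nonneg_left (norm_le_pi_norm x k) ht1.le).trans hbound
  -- With `y = x - x k`, homogeneity gives `f (t y) = f (t x) - t x k = x - t x k = (1 - t) x k +
  -- y`.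
  refine ⟨(1 - t) * x k, abs_le.1 hnorm, fun j => ((x j - x k : ℝ) : Rmax), ⟨fun j => ?_, k, ?_⟩,
    fun j => ?_, fun ν z hz h => ?_⟩
  · exact WithBot.coe_le_coe.2 (sub_nonpos.2 (hk j))
  · exact congrArg _ (sub_self (x k))
  · have e : (fun j => scale t ((x j - x k : ℝ) : Rmax)) =
        fun j => ((-(t * x k) + (t • x) j : ℝ) : Rmax) := by
      funext j
      rw [scale, WithBot.map_coe, hmax, WithBot.coe_inj, Pi.smul_apply, smul_eq_mul]
      ring
    rw [e, ← hg, gshift, hx, ← WithBot.coe_add, WithBot.coe_inj]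
    ring
  · classical
    -- On the support of `z`, `p` minimizes `x - z` and `q` maximizes `z`; the default `0` is never
    -- used there. The constant in `hle` is the resulting lower bound for `t x - z`. Applying `f` at
    -- `p` gives `ν ≤ (1 - t)(x p - z p + z q) ≤ (1 - t) x q ≤ (1 - t) x k`.
    obtain ⟨p, hp, hpmin⟩ := Finset.exists_min_image (Finset.univ.filter fun j => z j ≠ ⊥)
      (fun j => x j - (z j).unbotD 0) (by simpa [Finset.filter_nonempty_iff] using hz)
    obtain ⟨q, hq, hqmax⟩ := Finset.exists_max_image (Finset.univ.filter fun j => z j ≠ ⊥)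
      (fun j => (z j).unbotD 0) (by simpa [Finset.filter_nonempty_iff] using hz)
    simp only [Finset.mem_filter, Finset.mem_univ, true_and] at hp hpmin hq hqmax
    obtain ⟨zp, hzp⟩ := WithBot.ne_bot_iff_exists.1 hp
    obtain ⟨zq, hzq⟩ := WithBot.ne_bot_iff_exists.1 hq
    have hle : (fun j => ((t * (x p - zp) - (1 - t) * zq : ℝ) : Rmax) + z j) ≤
        fun j => (((t • x) j : ℝ) : Rmax) := fun j => by
      by_cases hj : z j = ⊥
      · simp [hj]
      · have h1 := hpmin j hj
        have h2 := hqmax j hj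
        obtain ⟨zj, hzj⟩ := WithBot.ne_bot_iff_exists.1 hj
        simp only [← hzj, ← hzp, ← hzq, WithBot.unbotD_coe] at h1 h2 ⊢
        rw [← WithBot.coe_add, WithBot.coe_le_coe, Pi.smul_apply, smul_eq_mul]
        nlinarith [mul_le_mul_of_nonneg_left h1 (by linarith [ht.1] : 0 ≤ t),
          mul_le_mul_of_nonneg_left h2 ht1.le]
    have h3 := hmono hle p
    rw [hshift, ← hg, hx] at h3
    have h4 := (add_le_add_right (h p) _).trans h3
    rw [← hzp, ← WithBot.coe_add, ← WithBot.coe_add, WithBot.coe_le_coe] at h4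
    have h5 := hpmin q hq
    simp only [← hzp, ← hzq, WithBot.unbotD_coe] at h5
    have h6 := mul_le_mul_of_nonneg_left (hk q) ht1.le
    nlinarith [mul_le_mul_of_nonneg_left h5 ht1.le]

/-- A continuous, monotone, additively homogeneous self-map of `Rmax^n` that preserves `ℝ^n` has a
real eigenvalue that bounds all its subeigenvalues. -/
theorem exists_eigenvalue (hn : 0 < n) {f : (Fin n → Rmax) → Fin n → Rmax}
    (hmono : Monotone f) (hcont : Continuous f)
    (hshift : ∀ (c : ℝ) x j, f (fun j => (c : Rmax) + x j) j = (c : Rmax) + f x j)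
    (hreal : ∀ (x : Fin n → ℝ) j, f (fun j => (x j : Rmax)) j ≠ ⊥) :
    ∃ μ : ℝ, (∃ x : Fin n → Rmax, (∃ j, x j ≠ ⊥) ∧ ∀ j, f x j = (μ : Rmax) + x j) ∧
      ∀ (ν : ℝ) (z : Fin n → Rmax), (∃ j, z j ≠ ⊥) → (∀ j, (ν : Rmax) + z j ≤ f z j) → ν ≤ μ := by
  obtain ⟨M, hM⟩ := exists_discounted_eigenvalue hn hmono hshift hreal
  set S : Set ℝ := {ν | ∃ z : Fin n → Rmax, (∃ j, z j ≠ ⊥) ∧ ∀ j, (ν : Rmax) + z j ≤ f z j}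
  -- Discounted equation and subeigenvalue bound are both closed conditions, and the last two
  -- factors are compact. The set of admissible `t` is therefore closed; it contains `[1/2, 1)`,
  -- hence `1`.
  set C : Set (ℝ × (Icc (-M) M × normalized n)) :=
    {p | (∀ j, f (fun j => scale p.1 (p.2.2.1 j)) j = ((p.2.1 : ℝ) : Rmax) + p.2.2.1 j) ∧
      ∀ ν ∈ S, ν ≤ (p.2.1 : ℝ)} with hC
  have hclosed : IsClosed C := by
    have hy : ∀ j, Continuous fun p : ℝ × (Icc (-M) M × normalized n) => p.2.2.1 j := fun j =>
      (continuous_apply j).comp (continuous_subtype_val.comp (continuous_snd.comp continuous_snd))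
    have hμ : Continuous fun p : ℝ × (Icc (-M) M × normalized n) => (p.2.1 : ℝ) :=
      continuous_subtype_val.comp (continuous_fst.comp continuous_snd)
    have hs : Continuous fun p : ℝ × (Icc (-M) M × normalized n) =>
        fun j => scale p.1 (p.2.2.1 j) :=
      continuous_pi fun j => continuous_scale.comp (continuous_fst.prodMk (hy j))
    simp only [hC, ofPred_and, ofPred_forall]
    exact (isClosed_iInter fun j => isClosed_eq ((continuous_apply j).comp (hcont.comp hs))
      (continuous_coe_add.comp (hμ.prodMk (hy j)))).inter
        (isClosed_iInter fun ν => isClosed_iInter fun _ => isClosed_le continuous_const hμ)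
  have himage := isClosedMap_fst_of_compactSpace _ hclosed
  have hsub : Ico (1 / 2 : ℝ) 1 ⊆ Prod.fst '' C := fun t ht => by
    obtain ⟨μ, hμ, y, hy, h1, h2⟩ := hM t ht
    exact ⟨(t, ⟨μ, hμ⟩, ⟨y, hy⟩), ⟨h1, fun ν ⟨z, hz, h⟩ => h2 ν z hz h⟩, rfl⟩
  have hone : (1 : ℝ) ∈ Prod.fst '' C := by
    refine himage.closure_subset_iff.2 hsub ?_
    rw [closure_Ico (by norm_num)]
    norm_num
  obtain ⟨⟨t, μ, y, hy, j, hj⟩, ⟨h1, h2⟩, rfl : t = 1⟩ := hone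
  simp only [scale_one] at h1
  exact ⟨μ, ⟨y, ⟨j, by simp [hj]⟩, h1⟩, fun ν z hz h => h2 ν ⟨z, hz, h⟩⟩

end Eigenvalue

/-! ### Decomposition of the spectrum into convex pieces -/

section Pieces

/-- The combination `s a + t b` in `Rmax`, which is `⊥` if `a` or `b` is. -/
noncomputable def comb (s t : ℝ) : Rmax → Rmax → Rmax := WithBot.map₂ fun a b => s * a + t * b

theorem comb_mono {s t : ℝ} (hs : 0 ≤ s) (ht : 0 ≤ t) {a a' b b' : Rmax} (ha : a ≤ a')
    (hb : b ≤ b') : comb s t a b ≤ comb s t a' b' := by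
  induction a using WithBot.recBotCoe with
  | bot => exact bot_le
  | coe a =>
    induction b using WithBot.recBotCoe with
    | bot => exact bot_le
    | coe b =>
      lift a' to ℝ using ne_bot_of_le_ne_bot WithBot.coe_ne_bot ha
      lift b' to ℝ using ne_bot_of_le_ne_bot WithBot.coe_ne_bot hb
      rw [WithBot.coe_le_coe] at ha hb
      exact WithBot.coe_le_coe.2
        (add_le_add (mul_le_mul_of_nonneg_left ha hs) (mul_le_mul_of_nonneg_left hb ht))

theorem comb_add (s t c d : ℝ) (a b : Rmax) :
    comb s t ((c : Rmax) + a) ((d : Rmax) + b) = ((s * c + t * d : ℝ) : Rmax) + comb s t a b := by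
  induction a using WithBot.recBotCoe with
  | bot => simp [comb]
  | coe a =>
    induction b using WithBot.recBotCoe with
    | bot => simp [comb]
    | coe b =>
      simp only [comb, ← WithBot.coe_add, WithBot.map₂_coe_coe]
      rw [WithBot.coe_inj]; ring

theorem comb_add_left {s t : ℝ} (hst : s + t = 1) (c a b : Rmax) :
    comb s t (c + a) (c + b) = c + comb s t a b := by
  induction c using WithBot.recBotCoe with
  | bot => simp [comb]
  | coe c => rw [comb_add, ← add_mul, hst, one_mul]

variable {m n : ℕ} (A B : Matrix (Fin m) (Fin n) Rmax)

/-- The inequality `≤` needs no common maximizer; the shared index `k` gives the reverse one. -/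
theorem act_comb {s t : ℝ} (hs : 0 ≤ s) (ht : 0 ≤ t) (hst : s + t = 1) {x y : Fin n → Rmax}
    {i : Fin m} {k : Fin n} (hx : act A x i = A i k + x k) (hy : act A y i = A i k + y k) :
    act A (fun j => comb s t (x j) (y j)) i = comb s t (act A x i) (act A y i) := by
  refine le_antisymm ((act_le_iff A).2 fun j => ?_) ?_
  · rw [← comb_add_left hst]
    exact comb_mono hs ht (le_act A x i j) (le_act A y i j)
  · rw [hx, hy, comb_add_left hst]
    exact le_act A (fun j => comb s t (x j) (y j)) i k

/-- The spectral values with an eigenvector that is finite at `k` and for which the maxima that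
define `A x` and `B x` are attained at the indices `σ` and `τ`. -/
def specPiece (p : Fin n × (Fin m → Fin n) × (Fin m → Fin n)) : Set ℝ :=
  {l | ∃ x : Fin n → Rmax, x p.1 ≠ ⊥ ∧ ∀ i, act A x i = A i (p.2.1 i) + x (p.2.1 i) ∧
    act B x i = B i (p.2.2 i) + x (p.2.2 i) ∧ act A x i = (l : Rmax) + act B x i}

theorem spec_eq_iUnion_specPiece : spec A B = ⋃ p, specPiece A B p := by
  ext l
  rw [mem_iUnion]
  constructor
  · rintro ⟨x, ⟨k, hk⟩, h⟩
    choose σ hσ using exists_act_eq A k.pos x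
    choose τ hτ using exists_act_eq B k.pos x
    exact ⟨(k, σ, τ), x, hk, fun i => ⟨hσ i, hτ i, h i⟩⟩
  · rintro ⟨p, x, hx, h⟩
    exact ⟨x, ⟨p.1, hx⟩, fun i => (h i).2.2⟩

/-- Combining two solutions combines their spectral values with the same weights. The common finite
coordinate `p.1` keeps the combined vector from being identically `⊥`. -/
theorem convex_specPiece (p : Fin n × (Fin m → Fin n) × (Fin m → Fin n)) :
    Convex ℝ (specPiece A B p) := by
  rintro l ⟨x, hx, h⟩ l' ⟨x', hx', h'⟩ s t hs ht hst
  have hA i := act_comb A hs ht hst (h i).1 (h' i).1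
  have hB i := act_comb B hs ht hst (h i).2.1 (h' i).2.1
  refine ⟨fun j => comb s t (x j) (x' j), ?_, fun i => ⟨?_, ?_, ?_⟩⟩
  · obtain ⟨a, ha⟩ := WithBot.ne_bot_iff_exists.1 hx
    obtain ⟨b, hb⟩ := WithBot.ne_bot_iff_exists.1 hx'
    simp only [← ha, ← hb]
    exact WithBot.coe_ne_bot
  · rw [hA, (h i).1, (h' i).1, comb_add_left hst]
  · rw [hB, (h i).2.1, (h' i).2.1, comb_add_left hst]
  · rw [hA, hB, (h i).2.2, (h' i).2.2, comb_add, smul_eq_mul, smul_eq_mul]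

theorem isClosedInterval_of_convex {I : Set ℝ} (hI : Convex ℝ I) (hc : IsClosed I)
    (hne : I.Nonempty) : IsClosedInterval I := by
  have ho : I.OrdConnected := hI.ordConnected
  by_cases ha : BddBelow I <;> by_cases hb : BddAbove I
  · have h1 := hc.csInf_mem hne ha
    have h2 := hc.csSup_mem hne hb
    exact Or.inl ⟨sInf I, sSup I, csInf_le ha h2,
      subset_antisymm (fun x hx => ⟨csInf_le ha hx, le_csSup hb hx⟩) (ho.out h1 h2)⟩
  · have h1 := hc.csInf_mem hne ha
    refine Or.inr (Or.inl ⟨sInf I, subset_antisymm (fun x hx => csInf_le ha hx) fun x hx => ?_⟩)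
    obtain ⟨y, hy, hxy⟩ := not_bddAbove_iff.1 hb x
    exact ho.out h1 hy ⟨hx, hxy.le⟩
  · have h2 := hc.csSup_mem hne hb
    refine Or.inr (Or.inr (Or.inl
      ⟨sSup I, subset_antisymm (fun x hx => le_csSup hb hx) fun x hx => ?_⟩))
    obtain ⟨y, hy, hxy⟩ := not_bddBelow_iff.1 ha x
    exact ho.out hy h2 ⟨hxy.le, hx⟩
  · refine Or.inr (Or.inr (Or.inr (eq_univ_of_forall fun x => ?_)))
    obtain ⟨y, hy, hxy⟩ := not_bddBelow_iff.1 ha x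
    obtain ⟨z, hz, hxz⟩ := not_bddAbove_iff.1 hb x
    exact ho.out hy hz ⟨hxy.le, hxz.le⟩

theorem spec_eq_sUnion_closedIntervals :
    ∃ F : Set (Set ℝ), F.Finite ∧ (∀ I ∈ F, IsClosedInterval I) ∧ spec A B = ⋃₀ F := by
  refine ⟨(fun p => closure (specPiece A B p)) '' {p | (specPiece A B p).Nonempty},
    (toFinite _).image _, ?_, ?_⟩
  · rintro _ ⟨p, hp, rfl⟩
    exact isClosedInterval_of_convex (convex_specPiece A B p).closure isClosed_closure hp.closure
  · rw [sUnion_image]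
    apply subset_antisymm
    · rw [spec_eq_iUnion_specPiece]
      exact iUnion_subset fun p l hl => mem_biUnion (show p ∈ {p | _} from ⟨l, hl⟩)
        (subset_closure hl)
    -- Closing a piece adds nothing outside the spectrum, since the spectrum is closed.
    · refine iUnion₂_subset fun p _ => (isClosed_spec A B).closure_subset_iff.2 ?_
      rw [spec_eq_iUnion_specPiece]
      exact subset_iUnion _ p

end Pieces

end MaxPlus

theorem mainTheorem2 {m n : ℕ} (hn : 0 < n) (A B : Matrix (Fin m) (Fin n) Rmax)
    (hA : ∀ i, ∃ j, A i j ≠ ⊥) (hB : ∀ i, ∃ j, B i j ≠ ⊥)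
    (hcol : ∀ j, ∃ i, A i j ≠ ⊥ ∨ B i j ≠ ⊥) :
    (∀ l : ℝ, IsGreatest {μ : Rmax | MaxPlus.IsEigenvalue (MaxPlus.minMax A B l) μ}
        (MaxPlus.specFun A B l)) ∧
    (∀ l : ℝ, MaxPlus.specFun A B l ≤ 0) ∧
    (∀ l : ℝ, MaxPlus.specFun A B l = 0 ↔ l ∈ MaxPlus.spec A B) ∧
    ((MaxPlus.spec A B).Nonempty →
      ∃ F : Set (Set ℝ), F.Finite ∧ (∀ I ∈ F, MaxPlus.IsClosedInterval I) ∧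
        MaxPlus.spec A B = ⋃₀ F) := by
  have key : ∀ l : ℝ, ∃ μ : ℝ,
      IsGreatest {μ : Rmax | MaxPlus.IsEigenvalue (MaxPlus.minMax A B l) μ} μ ∧
      ∀ (ν : ℝ) (z : Fin n → Rmax), (∃ j, z j ≠ ⊥) →
        (∀ j, (ν : Rmax) + z j ≤ MaxPlus.minMaxMap A B hcol l z j) → ν ≤ μ := fun l => by
    obtain ⟨μ, h1, h2⟩ := MaxPlus.exists_eigenvalue hn (MaxPlus.minMaxMap_mono hcol l)
      (MaxPlus.continuous_minMaxMap hcol l) (MaxPlus.minMaxMap_shift hcol l)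
      (MaxPlus.minMaxMap_ne_bot hcol hA hB l)
    refine ⟨μ, ⟨(MaxPlus.isEigenvalue_minMax_iff hcol l μ).2 h1, fun ν hν => ?_⟩, h2⟩
    obtain ⟨z, hz, h⟩ := (MaxPlus.isEigenvalue_minMax_iff hcol l ν).1 hν
    induction ν using WithBot.recBotCoe with
    | bot => exact bot_le
    | coe ν => exact WithBot.coe_le_coe.2 (h2 ν z hz fun j => (h j).ge)
  have heq : ∀ l (μ : Rmax),
      IsGreatest {μ : Rmax | MaxPlus.IsEigenvalue (MaxPlus.minMax A B l) μ} μ →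
      MaxPlus.specFun A B l = μ := fun l μ h => h.csSup_eq
  have hmax : ∀ l : ℝ, IsGreatest {μ : Rmax | MaxPlus.IsEigenvalue (MaxPlus.minMax A B l) μ}
      (MaxPlus.specFun A B l) := fun l => by
    obtain ⟨μ, h, -⟩ := key l
    rwa [heq l μ h]
  have hle : ∀ l : ℝ, MaxPlus.specFun A B l ≤ 0 := fun l => by
    obtain ⟨x, hx, h⟩ := (MaxPlus.isEigenvalue_minMax_iff hcol l _).1 (hmax l).1
    exact MaxPlus.subeigenvalue_nonpos hcol hx fun j => (h j).ge
  refine ⟨hmax, hle, fun l => ⟨fun h0 => ?_, ?_⟩, fun _ =>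
    MaxPlus.spec_eq_sUnion_closedIntervals A B⟩
  · obtain ⟨x, hx, h⟩ := (MaxPlus.isEigenvalue_minMax_iff hcol l _).1 (hmax l).1
    refine ⟨x, hx, (MaxPlus.le_minMaxMap_self_iff hcol l x).1 fun j => ?_⟩
    rw [h j, h0, zero_add]
  · rintro ⟨x, hx, h⟩
    obtain ⟨μ, hμ, hsub⟩ := key l
    refine le_antisymm (hle l) ?_
    rw [heq l μ hμ]
    refine WithBot.coe_le_coe.2 (hsub 0 x hx fun j => ?_)
    rw [WithBot.coe_zero, zero_add]
    exact (MaxPlus.le_minMaxMap_self_iff hcol l x).2 h j
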